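/- For every constant $c>0$ there are constants $C>0$ and $A\in\mathbb{N}$, depending only on $c$, such that the following holds. Let $G=(V,E,w)$ be a finite simple graph with $n=|V|$ vertices and pairwise distinct real edge weights, let $0<p\le 1$, and let $k\ge c\log n$ be an integer. Let $H$ be a random spanning subgraph of $G$ obtained by sampling the edges of $G$ with a $k$-wise independent sampler with probability $p$; that is, every edge of $G$ belongs to $H$ with probability $p$, and for every set of at most $k$ edges of $G$ the events that these edges belong to $H$ are mutually independent. Let $F$ be the maximal minimum weight spanning forest of $H$, i.e. the maximal acyclic subgraph of $H$ of minimum total weight. Call an edge $\{u,v\}$ of $G$ $F$-light if $w(u,v)\le w_F(u,v)$, where $w_F(u,v)$ is the maximum weight of an edge on the path from $u$ to $v$ in $F$, and $w_F(u,v)=\infty$ if there is no such path. Then, with probability at least $1-\frac1n$, the number of $F$-light edges of $G$ is at most $$C\,(\log n)^{A}\cdot\frac{n}{p}.$$ In particular, for $\Theta(\log n)$-wise independent sampling, the number of $F$-light edges of $G$ is $\widetilde O(n/p)$ with high probability. -/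

import Mathlib

open MeasureTheory ProbabilityTheory

universe u v

/-- Total weight of the edges of a finite graph. -/
noncomputable def graphWeight {V : Type u} [Fintype V] (w : Sym2 V → ℝ) (F : SimpleGraph V) : ℝ :=
  ∑ᶠ e ∈ F.edgeSet, w e

/-- `F` is a maximal spanning forest of `H`: an inclusion-maximal acyclic subgraph of `H`
(all graphs here have the whole of `V` as vertex set). -/
def IsMaximalForest {V : Type u} (H F : SimpleGraph V) : Prop :=
  Maximal (fun F' : SimpleGraph V => F' ≤ H ∧ F'.IsAcyclic) F

/-- `F` is a maximal minimum weight spanning forest of `H` for the edge weights `w`. -/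
def IsMinWeightForest {V : Type u} [Fintype V] (w : Sym2 V → ℝ) (H F : SimpleGraph V) : Prop :=
  IsMaximalForest H F ∧
    ∀ F' : SimpleGraph V, IsMaximalForest H F' → graphWeight w F ≤ graphWeight w F'

/-- `w_F(x, y)`: the maximum weight of an edge on the path from `x` to `y` in the forest `F`,
and `⊤` if there is no such path. The infimum is over a type with at most one element, since
paths in a forest are unique. -/
noncomputable def maxPathWeight {V : Type u} (w : Sym2 V → ℝ) (F : SimpleGraph V) (x y : V) :
    EReal :=
  ⨅ P : F.Path x y, ⨆ e ∈ (P : F.Walk x y).edges, (w e : EReal)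

/-- The set of `F`-light edges of `G`: the edges `{x, y}` of `G` that do not satisfy
`w(x, y) > w_F(x, y)`. -/
def lightEdges {V : Type u} (w : Sym2 V → ℝ) (G F : SimpleGraph V) : Set (Sym2 V) :=
  {e | e ∈ G.edgeSet ∧ ∀ x y : V, e = s(x, y) → (w e : EReal) ≤ maxPathWeight w F x y}

/-- The random spanning subgraph `H` of `G` is obtained by sampling every edge of `G` with
probability `p` using a `k`-wise independent sampler: every edge is kept with probability `p`,
and the events that the edges of `T` are kept are mutually independent for every set `T` of at
most `k` edges. -/
structure IsKWiseSample {V : Type u} {Ω : Type v} [MeasurableSpace Ω] (μ : Measure Ω)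
    (G : SimpleGraph V) (p : ℝ) (k : ℕ) (H : Ω → SimpleGraph V) : Prop where
  le : ∀ ω, H ω ≤ G
  measurableSet : ∀ e ∈ G.edgeSet, MeasurableSet {ω | e ∈ (H ω).edgeSet}
  prob : ∀ e ∈ G.edgeSet, μ.real {ω | e ∈ (H ω).edgeSet} = p
  indep : ∀ T : Finset (Sym2 V), (T : Set (Sym2 V)) ⊆ G.edgeSet → T.card ≤ k →
    iIndepSet (fun e : T => {ω | (e : Sym2 V) ∈ (H ω).edgeSet}) μ

/-!
Call an edge of `G` spanned if both its ends lie in an expander consisting of lighter edges. Few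
edges are not spanned: a set of edges that is too large contains a vertex set that is minimal among
those spanning too many of them, by minimality these edges form an expander, and the heaviest of
them is spanned by the others.

A spanned edge is light only if sampling disconnects its expander, since by the exchange property
of minimum weight forests every edge on the path of `F` between two vertices joined in `H` by edges
lighter than `t` is itself lighter than `t`. Sampling is unlikely to disconnect an expander: a cut
from which no edge is sampled is visible in the quadratic form of the normalized Laplacian weighted
by the centred samples, and a trace of a power of that matrix bounds the form. The expectation of
the trace is a sum over closed walks, in which only those meeting every edge at least twice
contribute; it involves `2 * r` samples at a time, so that `2 * r`-wise independence suffices.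
-/

open scoped Matrix

section TraceOfPowers

variable {n m R : Type*} [Fintype n]

lemma dotProduct_transpose_mul_diagonal_mul_mulVec [CommSemiring R] [Fintype m] [DecidableEq m]
    (B : Matrix m n R) (y : m → R) (x : n → R) :
    x ⬝ᵥ (Bᵀ * Matrix.diagonal y * B) *ᵥ x = ∑ e, y e * (B *ᵥ x) e ^ 2 := by
  rw [Matrix.mul_assoc, ← Matrix.mulVec_mulVec, Matrix.dotProduct_mulVec, Matrix.vecMul_transpose,
    ← Matrix.mulVec_mulVec]
  refine Finset.sum_congr rfl fun e _ => ?_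
  rw [Matrix.mulVec_diagonal]
  ring

variable [DecidableEq n]

lemma trace_pow_mul_eq_sum_walks [CommSemiring R] (N X : Matrix n n R) (k : ℕ) :
    (N ^ k * X).trace = ∑ f : Fin (k + 1) → n,
      (∏ i : Fin k, N (f i.castSucc) (f i.succ)) * X (f (Fin.last k)) (f 0) := by
  induction k generalizing X with
  | zero =>
    rw [← (Equiv.funUnique (Fin 1) n).symm.sum_comp]
    simp [Matrix.trace]
  | succ k ih =>
    rw [pow_succ, Matrix.mul_assoc, ih, ← (Fin.snocEquiv fun _ : Fin (k + 2) => n).sum_comp,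
      Fintype.sum_prod_type_right]
    refine Finset.sum_congr rfl fun f _ => ?_
    rw [Matrix.mul_apply, Finset.mul_sum]
    refine Finset.sum_congr rfl fun a _ => ?_
    have hzero : Fin.snoc (α := fun _ => n) f a 0 = f 0 := by
      rw [← Fin.castSucc_zero, Fin.snoc_castSucc]
    simp only [Fin.snocEquiv_apply, Fin.prod_univ_castSucc, Fin.snoc_castSucc, Fin.succ_last,
      Fin.snoc_last, ← Fin.castSucc_succ, hzero, mul_assoc]

lemma trace_diagonal_mul_pow_succ [CommSemiring R] (y : n → R) (Γ : Matrix n n R) (k : ℕ) :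
    ((Matrix.diagonal y * Γ) ^ (k + 1)).trace = ∑ f : Fin (k + 1) → n, (∏ i, y (f i)) *
      ((∏ i : Fin k, Γ (f i.castSucc) (f i.succ)) * Γ (f (Fin.last k)) (f 0)) := by
  rw [pow_succ, trace_pow_mul_eq_sum_walks]
  refine Finset.sum_congr rfl fun f _ => ?_
  simp only [Matrix.diagonal_mul, Finset.prod_mul_distrib, Fin.prod_univ_castSucc]
  ring

lemma trace_mul_pow_succ_comm [CommSemiring R] [Fintype m] [DecidableEq m] (A : Matrix m n R)
    (C : Matrix n m R) (k : ℕ) : ((A * C) ^ (k + 1)).trace = ((C * A) ^ (k + 1)).trace := by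
  have hshift : ∀ k, (A * C) ^ k * A = A * (C * A) ^ k := by
    intro k
    induction k with
    | zero => simp
    | succ k ih =>
      rw [pow_succ', Matrix.mul_assoc, ih, pow_succ', Matrix.mul_assoc, Matrix.mul_assoc]
  rw [pow_succ, ← Matrix.mul_assoc, hshift, Matrix.mul_assoc, Matrix.trace_mul_comm,
    Matrix.mul_assoc, ← pow_succ]

lemma trace_transpose_mul_diagonal_mul_pow_succ [CommSemiring R] [Fintype m] [DecidableEq m]
    (B : Matrix m n R) (y : m → R) (k : ℕ) :
    ((Bᵀ * Matrix.diagonal y * B) ^ (k + 1)).trace = ∑ f : Fin (k + 1) → m, (∏ i, y (f i)) *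
      ((∏ i : Fin k, (B * Bᵀ) (f i.castSucc) (f i.succ)) * (B * Bᵀ) (f (Fin.last k)) (f 0)) := by
  rw [Matrix.mul_assoc, trace_mul_pow_succ_comm, Matrix.mul_assoc, trace_diagonal_mul_pow_succ]

lemma trace_pow_eq_sum_eigenvalues_pow {A : Matrix n n ℝ} (hA : A.IsHermitian) (k : ℕ) :
    (A ^ k).trace = ∑ i, hA.eigenvalues i ^ k := by
  conv_lhs => rw [hA.spectral_theorem, ← map_pow, Unitary.conjStarAlgAut_apply,
    Matrix.trace_mul_cycle]
  simp [Matrix.diagonal_pow, Matrix.trace_diagonal]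

lemma trace_pow_two_mul_nonneg {A : Matrix n n ℝ} (hA : A.IsHermitian) (r : ℕ) :
    0 ≤ (A ^ (2 * r)).trace := by
  rw [trace_pow_eq_sum_eigenvalues_pow hA]
  exact Finset.sum_nonneg fun i _ => (even_two_mul r).pow_nonneg _

lemma exists_le_abs_eigenvalue {A : Matrix n n ℝ} (hA : A.IsHermitian) {x : n → ℝ} {t : ℝ}
    (hx : 0 < x ⬝ᵥ x) (ht : t * (x ⬝ᵥ x) ≤ |x ⬝ᵥ A *ᵥ x|) : ∃ i, t ≤ |hA.eigenvalues i| := by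
  by_contra! hlt
  let B : Matrix n n ℝ := star (hA.eigenvectorUnitary : Matrix n n ℝ)
  have hstar : Bᵀ = hA.eigenvectorUnitary := star_star (hA.eigenvectorUnitary : Matrix n n ℝ)
  have hB : Bᵀ * B = 1 := hstar ▸ Unitary.coe_mul_star_self hA.eigenvectorUnitary
  have hAB : A = Bᵀ * Matrix.diagonal hA.eigenvalues * B := by
    conv_lhs => rw [hA.spectral_theorem, Unitary.conjStarAlgAut_apply]
    rw [hstar]
    rfl
  have hxB : x ⬝ᵥ x = ∑ i, (B *ᵥ x) i ^ 2 := by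
    simpa [hB] using dotProduct_transpose_mul_diagonal_mul_mulVec B 1 x
  have hxAB : x ⬝ᵥ A *ᵥ x = ∑ i, hA.eigenvalues i * (B *ᵥ x) i ^ 2 := by
    rw [← dotProduct_transpose_mul_diagonal_mul_mulVec, ← hAB]
  obtain ⟨j, -, hj⟩ : ∃ j ∈ Finset.univ, 0 < (B *ᵥ x) j ^ 2 :=
    Finset.exists_lt_of_sum_lt (by simpa [← hxB] using hx)
  refine ht.not_gt ?_
  calc |x ⬝ᵥ A *ᵥ x| ≤ ∑ i, |hA.eigenvalues i| * (B *ᵥ x) i ^ 2 := by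
        rw [hxAB]
        refine (Finset.abs_sum_le_sum_abs _ _).trans_eq ?_
        simp only [abs_mul, abs_sq]
    _ < ∑ i, t * (B *ᵥ x) i ^ 2 :=
        Finset.sum_lt_sum (fun i _ => by gcongr; exact (hlt i).le)
          ⟨j, Finset.mem_univ j, by gcongr; exact hlt j⟩
    _ = t * (x ⬝ᵥ x) := by rw [hxB, Finset.mul_sum]

lemma pow_le_trace_pow {A : Matrix n n ℝ} (hA : A.IsHermitian) {x : n → ℝ} {t : ℝ}
    (hx : 0 < x ⬝ᵥ x) (ht0 : 0 ≤ t) (ht : t * (x ⬝ᵥ x) ≤ |x ⬝ᵥ A *ᵥ x|) (r : ℕ) :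
    t ^ (2 * r) ≤ (A ^ (2 * r)).trace := by
  obtain ⟨i, hi⟩ := exists_le_abs_eigenvalue hA hx ht
  rw [trace_pow_eq_sum_eigenvalues_pow hA]
  calc t ^ (2 * r) ≤ |hA.eigenvalues i| ^ (2 * r) := by gcongr
    _ = hA.eigenvalues i ^ (2 * r) := (even_two_mul r).pow_abs _
    _ ≤ _ := Finset.single_le_sum (fun j _ => (even_two_mul r).pow_nonneg _) (Finset.mem_univ i)

end TraceOfPowers

section WalkCounting

variable {E : Type*}

lemma image_univ_cons [DecidableEq E] {k : ℕ} (e : E) (f : Fin k → E) :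
    Finset.univ.image (Fin.cons e f : Fin (k + 1) → E) = insert e (Finset.univ.image f) := by
  ext a
  simp [Fin.exists_fin_succ, eq_comm]

variable [Fintype E]

lemma abs_prod_walk_mul_le {Γ : E → E → ℝ} {a : ℝ} (hsum : ∀ f, ∑ e, |Γ e f| ≤ a) {j : ℕ}
    (f : Fin (j + 1) → E) :
    |(∏ i : Fin j, Γ (f i.castSucc) (f i.succ)) * Γ (f (Fin.last j)) (f 0)| ≤
      a * ∏ i : Fin j, |Γ (f i.castSucc) (f i.succ)| := by
  rw [abs_mul, Finset.abs_prod, mul_comm a]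
  gcongr
  exact (Finset.single_le_sum (f := fun e => |Γ e (f 0)|) (fun _ _ => abs_nonneg _)
    (Finset.mem_univ _)).trans (hsum _)

variable [DecidableEq E]

lemma sum_pow_card_insert_mul_le {g : E → ℝ} {a δ : ℝ} (hδ : 0 ≤ δ) (hg0 : ∀ e, 0 ≤ g e)
    (hg : ∀ e, g e ≤ a * δ) (hsum : ∑ e, g e ≤ a) (S : Finset E) :
    ∑ e, δ ^ (insert e S).card * g e ≤ (S.card + 1) * (a * δ) * δ ^ S.card := by
  have hterm : ∀ e, δ ^ (insert e S).card * g e ≤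
      δ ^ S.card * (δ * g e + if e ∈ S then a * δ else 0) := by
    intro e
    split_ifs with he
    · rw [Finset.insert_eq_of_mem he]
      have := mul_nonneg hδ (hg0 e)
      gcongr
      linarith [hg e]
    · rw [Finset.card_insert_of_notMem he, pow_succ, add_zero, mul_assoc]
  calc ∑ e, δ ^ (insert e S).card * g e
      ≤ ∑ e, δ ^ S.card * (δ * g e + if e ∈ S then a * δ else 0) :=
        Finset.sum_le_sum fun e _ => hterm e
    _ = δ ^ S.card * (δ * ∑ e, g e + S.card * (a * δ)) := by
        rw [← Finset.mul_sum, Finset.sum_add_distrib, ← Finset.mul_sum, Finset.sum_ite_mem,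
          Finset.univ_inter, Finset.sum_const, nsmul_eq_mul]
    _ ≤ δ ^ S.card * (δ * a + S.card * (a * δ)) := by gcongr
    _ = (S.card + 1) * (a * δ) * δ ^ S.card := by ring

lemma sum_walks_le {h : E → E → ℝ} {a δ : ℝ} (ha : 0 ≤ a) (hδ : 0 ≤ δ) (h0 : ∀ e f, 0 ≤ h e f)
    (hle : ∀ e f, h e f ≤ a * δ) (hsum : ∀ f, ∑ e, h e f ≤ a) (k : ℕ) :
    ∑ f : Fin (k + 1) → E,
        δ ^ (Finset.univ.image f).card * ∏ i : Fin k, h (f i.castSucc) (f i.succ) ≤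
      Fintype.card E * a ^ k * (k + 1).factorial * δ ^ (k + 1) := by
  induction k with
  | zero =>
    rw [← (Equiv.funUnique (Fin 1) E).symm.sum_comp]
    simp
  | succ k ih =>
    have hstep : ∀ f : Fin (k + 1) → E,
        ∑ e, δ ^ (insert e (Finset.univ.image f)).card * h e (f 0) ≤
          (k + 2) * (a * δ) * δ ^ (Finset.univ.image f).card := by
      intro f
      refine (sum_pow_card_insert_mul_le hδ (fun e => h0 e _) (fun e => hle e _)
        (hsum _) _).trans ?_
      have hcard : ((Finset.univ.image f).card : ℝ) ≤ k + 1 := by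
        simpa using (Nat.cast_le (α := ℝ)).2 (Finset.card_image_le (s := Finset.univ) (f := f))
      exact mul_le_mul_of_nonneg_right
        (mul_le_mul_of_nonneg_right (by linarith) (by positivity)) (by positivity)
    have hcons : ∀ (e : E) (f : Fin (k + 1) → E),
        Fin.consEquiv (fun _ => E) (e, f) = Fin.cons e f := fun _ _ => rfl
    calc ∑ f : Fin (k + 2) → E,
          δ ^ (Finset.univ.image f).card * ∏ i : Fin (k + 1), h (f i.castSucc) (f i.succ)
        = ∑ f : Fin (k + 1) → E, (∑ e, δ ^ (insert e (Finset.univ.image f)).card * h e (f 0)) *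
            ∏ i : Fin k, h (f i.castSucc) (f i.succ) := by
          rw [← (Fin.consEquiv fun _ => E).sum_comp, Fintype.sum_prod_type_right]
          simp only [hcons, image_univ_cons, Fin.prod_univ_succ, Fin.castSucc_zero,
            Fin.cons_zero, Fin.cons_succ, ← Fin.succ_castSucc, Finset.sum_mul, mul_assoc]
      _ ≤ ∑ f : Fin (k + 1) → E, ((k + 2) * (a * δ) * δ ^ (Finset.univ.image f).card) *
            ∏ i : Fin k, h (f i.castSucc) (f i.succ) := by
          gcongr with f
          · exact Finset.prod_nonneg fun i _ => h0 _ _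
          · exact hstep f
      _ ≤ (k + 2) * (a * δ) * (Fintype.card E * a ^ k * (k + 1).factorial * δ ^ (k + 1)) := by
          simp only [mul_assoc _ (δ ^ _) (∏ _, _), ← Finset.mul_sum]
          gcongr
      _ = _ := by
          rw [Nat.factorial_succ (k + 1)]
          push_cast
          ring

end WalkCounting

section Noise

/-- A family of centred `[-1, 1]`-valued random variables of variance at most `p`, any `k` of which
are independent: the only features of a centred `k`-wise independent sample that the trace method
uses. -/
structure IsKWiseNoise {E : Type*} {Ω : Type v} [MeasurableSpace Ω] (μ : Measure Ω) (p : ℝ) (k : ℕ)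
    (Y : E → Ω → ℝ) : Prop where
  measurable : ∀ e, Measurable (Y e)
  abs_le_one : ∀ e ω, |Y e ω| ≤ 1
  integral_eq_zero : ∀ e, ∫ ω, Y e ω ∂μ = 0
  integral_sq_le : ∀ e, ∫ ω, Y e ω ^ 2 ∂μ ≤ p
  iIndepFun : ∀ T : Finset E, T.card ≤ k → iIndepFun (fun e : T => Y e) μ

namespace IsKWiseNoise

variable {E ι : Type*} {Ω : Type v} [MeasurableSpace Ω] {μ : Measure Ω} {p δ : ℝ} {k r : ℕ}
  {Y : E → Ω → ℝ}

lemma abs_integral_pow_le [IsProbabilityMeasure μ] (hY : IsKWiseNoise μ p k Y) (e : E) {j : ℕ}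
    (hj : 2 ≤ j) : |∫ ω, Y e ω ^ j ∂μ| ≤ p := by
  have hle : ∀ ω, |Y e ω ^ j| ≤ Y e ω ^ 2 := fun ω => by
    rw [abs_pow, ← sq_abs (Y e ω)]
    exact pow_le_pow_of_le_one (abs_nonneg _) (hY.abs_le_one e ω) hj
  have hint : Integrable (fun ω => Y e ω ^ 2) μ :=
    .of_bound ((hY.measurable e).pow_const 2).aestronglyMeasurable 1 <| ae_of_all _ fun ω => by
      simpa using pow_le_one₀ (n := 2) (abs_nonneg _) (hY.abs_le_one e ω)
  calc |∫ ω, Y e ω ^ j ∂μ| ≤ ∫ ω, |Y e ω ^ j| ∂μ := abs_integral_le_integral_abs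
    _ ≤ ∫ ω, Y e ω ^ 2 ∂μ :=
        integral_mono_of_nonneg (ae_of_all _ fun _ => abs_nonneg _) hint (ae_of_all _ hle)
    _ ≤ p := hY.integral_sq_le e

lemma integrable_prod [IsFiniteMeasure μ] (hY : IsKWiseNoise μ p k Y) [Fintype ι] (f : ι → E) :
    Integrable (fun ω => ∏ i, Y (f i) ω) μ := by
  refine .of_bound (Finset.measurable_fun_prod _ fun i _ =>
    hY.measurable (f i)).aestronglyMeasurable 1 <| ae_of_all _ fun ω => ?_
  rw [Real.norm_eq_abs, Finset.abs_prod]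
  exact Finset.prod_le_one (fun _ _ => abs_nonneg _) fun i _ => hY.abs_le_one _ _

lemma integral_prod_eq [DecidableEq E] [Fintype ι] (hY : IsKWiseNoise μ p k Y) (f : ι → E)
    (hk : Fintype.card ι ≤ k) : ∫ ω, ∏ i, Y (f i) ω ∂μ =
      ∏ e ∈ Finset.univ.image f, ∫ ω, Y e ω ^ (Finset.univ.filter (f · = e)).card ∂μ := by
  set T := Finset.univ.image f
  have hindep := (hY.iIndepFun T (Finset.card_image_le.trans hk)).comp
    (fun (e : T) (z : ℝ) => z ^ (Finset.univ.filter (f · = (e : E))).card) fun e => by fun_prop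
  have hprod := hindep.integral_fun_prod_eq_prod_integral fun e =>
    ((hY.measurable e).pow_const _).aestronglyMeasurable
  simp only [Function.comp_apply] at hprod
  rw [← Finset.prod_coe_sort, ← hprod]
  refine integral_congr_ae (ae_of_all _ fun ω => ?_)
  exact (Finset.prod_comp (fun e => Y e ω) f).trans (Finset.prod_coe_sort T _).symm

/-- An index met exactly once kills the moment, so at most `r` distinct indices occur. -/
lemma abs_integral_prod_le [IsProbabilityMeasure μ] [DecidableEq E] [Fintype ι]
    (hY : IsKWiseNoise μ p k Y) (hδ : 0 < δ) (hδp : δ ≤ p) (f : ι → E)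
    (hι : Fintype.card ι = 2 * r) (hk : 2 * r ≤ k) :
    |∫ ω, ∏ i, Y (f i) ω ∂μ| ≤ (p / δ) ^ r * δ ^ (Finset.univ.image f).card := by
  have hp : 0 < p := hδ.trans_le hδp
  rw [hY.integral_prod_eq f (hι.trans_le hk)]
  by_cases hone : ∃ e ∈ Finset.univ.image f, (Finset.univ.filter (f · = e)).card = 1
  · obtain ⟨e, he, hcard⟩ := hone
    have hzero : ∫ ω, Y e ω ^ (Finset.univ.filter (f · = e)).card ∂μ = 0 := by
      simpa [hcard] using hY.integral_eq_zero e
    rw [Finset.prod_eq_zero he hzero, abs_zero]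
    positivity
  have htwo : ∀ e ∈ Finset.univ.image f, 2 ≤ (Finset.univ.filter (f · = e)).card := by
    intro e he
    obtain ⟨i, -, hi⟩ := Finset.mem_image.1 he
    have hpos : 0 < (Finset.univ.filter (f · = e)).card := Finset.card_pos.2 ⟨i, by simpa using hi⟩
    have hne : (Finset.univ.filter (f · = e)).card ≠ 1 := fun h => hone ⟨e, he, h⟩
    omega
  have hcard : (Finset.univ.image f).card ≤ r := by
    have := Finset.mul_card_image_le_card Finset.univ 2 htwo
    rw [Finset.card_univ, hι] at this
    omega
  rw [Finset.abs_prod]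
  calc ∏ e ∈ Finset.univ.image f, |∫ ω, Y e ω ^ (Finset.univ.filter (f · = e)).card ∂μ|
      ≤ p ^ (Finset.univ.image f).card :=
        (Finset.prod_le_prod (fun _ _ => abs_nonneg _) fun e he =>
          hY.abs_integral_pow_le e (htwo e he)).trans_eq (Finset.prod_const p)
    _ = (p / δ) ^ (Finset.univ.image f).card * δ ^ (Finset.univ.image f).card := by
        rw [← mul_pow, div_mul_cancel₀ _ hδ.ne']
    _ ≤ (p / δ) ^ r * δ ^ (Finset.univ.image f).card := by
        gcongr
        exact (one_le_div hδ).2 hδp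

variable {V : Type*} [Fintype E] [DecidableEq E] [Fintype V]

lemma integrable_trace_pow_succ [DecidableEq V] [IsFiniteMeasure μ] (hY : IsKWiseNoise μ p k Y)
    (B : Matrix E V ℝ) (j : ℕ) :
    Integrable (fun ω => ((Bᵀ * Matrix.diagonal (Y · ω) * B) ^ (j + 1)).trace) μ := by
  simp only [trace_transpose_mul_diagonal_mul_pow_succ]
  exact integrable_finsetSum _ fun f _ => (hY.integrable_prod f).mul_const _

lemma integral_trace_pow_le [DecidableEq V] [IsProbabilityMeasure μ] {a : ℝ}
    (hY : IsKWiseNoise μ p k Y) (hδ : 0 < δ) (hδp : δ ≤ p) (ha : 0 ≤ a) {B : Matrix E V ℝ}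
    (hentry : ∀ e f, |(B * Bᵀ) e f| ≤ a * δ) (hsum : ∀ f, ∑ e, |(B * Bᵀ) e f| ≤ a) (hr : r ≠ 0)
    (hk : 2 * r ≤ k) :
    ∫ ω, ((Bᵀ * Matrix.diagonal (Y · ω) * B) ^ (2 * r)).trace ∂μ ≤
      Fintype.card E * (2 * r).factorial * (a ^ 2 * p * δ) ^ r := by
  obtain ⟨j, hj⟩ : ∃ j, 2 * r = j + 1 := Nat.exists_eq_succ_of_ne_zero (by omega)
  have hp : 0 < p := hδ.trans_le hδp
  set Γ := B * Bᵀ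
  have hmoment : ∀ f : Fin (j + 1) → E, |∫ ω, ∏ i, Y (f i) ω ∂μ| ≤
      (p / δ) ^ r * δ ^ (Finset.univ.image f).card := fun f =>
    hY.abs_integral_prod_le hδ hδp f (by rw [Fintype.card_fin, hj]) hk
  simp only [hj, trace_transpose_mul_diagonal_mul_pow_succ]
  rw [integral_finsetSum _ fun f _ => (hY.integrable_prod f).mul_const _]
  simp only [integral_mul_const]
  calc ∑ f : Fin (j + 1) → E, (∫ ω, ∏ i, Y (f i) ω ∂μ) *
          ((∏ i : Fin j, Γ (f i.castSucc) (f i.succ)) * Γ (f (Fin.last j)) (f 0))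
      ≤ ∑ f : Fin (j + 1) → E, (p / δ) ^ r * δ ^ (Finset.univ.image f).card *
          (a * ∏ i : Fin j, |Γ (f i.castSucc) (f i.succ)|) := by
        refine Finset.sum_le_sum fun f _ => (le_abs_self _).trans ?_
        rw [abs_mul]
        exact mul_le_mul (hmoment f) (abs_prod_walk_mul_le hsum f) (abs_nonneg _) (by positivity)
    _ = (p / δ) ^ r * a * ∑ f : Fin (j + 1) → E, δ ^ (Finset.univ.image f).card *
          ∏ i : Fin j, |Γ (f i.castSucc) (f i.succ)| := by
        rw [Finset.mul_sum]
        exact Finset.sum_congr rfl fun f _ => by ring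
    _ ≤ (p / δ) ^ r * a * (Fintype.card E * a ^ j * (j + 1).factorial * δ ^ (j + 1)) := by
        gcongr
        exact sum_walks_le ha hδ.le (fun _ _ => abs_nonneg _) hentry hsum j
    _ = Fintype.card E * (j + 1).factorial * ((p / δ) ^ r * (a ^ (2 * r) * δ ^ (2 * r))) := by
        rw [hj]
        ring
    _ = Fintype.card E * (j + 1).factorial * (a ^ 2 * p * δ) ^ r := by
        rw [pow_mul, pow_mul, ← mul_pow, ← mul_pow]
        congr 2
        field_simp

theorem measureReal_exists_le_abs_dotProduct_mulVec_le [IsProbabilityMeasure μ] {a t : ℝ}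
    (hY : IsKWiseNoise μ p k Y) (hδ : 0 < δ) (hδp : δ ≤ p) (ha : 0 ≤ a) (ht : 0 < t)
    {B : Matrix E V ℝ} (hentry : ∀ e f, |(B * Bᵀ) e f| ≤ a * δ)
    (hsum : ∀ f, ∑ e, |(B * Bᵀ) e f| ≤ a) (hr : r ≠ 0) (hk : 2 * r ≤ k) :
    μ.real {ω | ∃ x, 0 < x ⬝ᵥ x ∧
        t * (x ⬝ᵥ x) ≤ |x ⬝ᵥ (Bᵀ * Matrix.diagonal (Y · ω) * B) *ᵥ x|} ≤
      Fintype.card E * (2 * r).factorial * (a ^ 2 * p * δ / t ^ 2) ^ r := by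
  classical
  set M : Ω → Matrix V V ℝ := fun ω => Bᵀ * Matrix.diagonal (Y · ω) * B
  have hM : ∀ ω, (M ω).IsHermitian := fun ω => by
    simp [M, Matrix.IsHermitian, Matrix.conjTranspose_eq_transpose_of_trivial, Matrix.mul_assoc]
  have hint : Integrable (fun ω => (M ω ^ (2 * r)).trace) μ := by
    have := hY.integrable_trace_pow_succ B (2 * r - 1)
    rwa [Nat.sub_add_cancel (by omega)] at this
  have hmarkov : t ^ (2 * r) * μ.real {ω | t ^ (2 * r) ≤ (M ω ^ (2 * r)).trace} ≤
      Fintype.card E * (2 * r).factorial * (a ^ 2 * p * δ) ^ r :=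
    (mul_meas_ge_le_integral_of_nonneg (ae_of_all _ fun ω => trace_pow_two_mul_nonneg (hM ω) r)
      hint _).trans (hY.integral_trace_pow_le hδ hδp ha hentry hsum hr hk)
  calc _ ≤ μ.real {ω | t ^ (2 * r) ≤ (M ω ^ (2 * r)).trace} :=
        measureReal_mono (by rintro ω ⟨x, hx, hle⟩; exact pow_le_trace_pow (hM ω) hx ht.le hle r)
    _ ≤ Fintype.card E * (2 * r).factorial * (a ^ 2 * p * δ) ^ r / t ^ (2 * r) := by
        rwa [le_div_iff₀ (by positivity), mul_comm]
    _ = _ := by rw [div_pow, ← pow_mul, mul_div_assoc]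

end IsKWiseNoise

end Noise

section CentredIndicator

variable {Ω : Type v} [MeasurableSpace Ω] {μ : Measure Ω} {p : ℝ}

lemma integral_indicator_sub_sq [IsProbabilityMeasure μ] {X : Set Ω} (hX : MeasurableSet X) :
    ∫ ω, (X.indicator 1 ω - μ.real X) ^ 2 ∂μ = μ.real X * (1 - μ.real X) := by
  have hsq : ∀ ω, (X.indicator (1 : Ω → ℝ) ω - μ.real X) ^ 2 =
      (1 - 2 * μ.real X) * X.indicator 1 ω + μ.real X ^ 2 := fun ω => by
    by_cases h : ω ∈ X
    · simp only [h, Set.indicator_of_mem, Pi.one_apply]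
      ring
    · simp [h]
  have hint : Integrable (X.indicator (1 : Ω → ℝ)) μ := (integrable_const 1).indicator hX
  simp only [hsq]
  rw [integral_add (hint.const_mul _) (integrable_const _), integral_const_mul,
    integral_indicator_one hX, integral_const, probReal_univ, one_smul]
  ring

lemma isKWiseNoise_indicator_sub [IsProbabilityMeasure μ] {E : Type*} {X : E → Set Ω} {k : ℕ}
    (hX : ∀ e, MeasurableSet (X e)) (hp : ∀ e, μ.real (X e) = p)
    (hindep : ∀ T : Finset E, T.card ≤ k → iIndepSet (fun e : T => X e) μ) :
    IsKWiseNoise μ p k fun e ω => (X e).indicator 1 ω - p where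
  measurable e := (measurable_one.indicator (hX e)).sub_const p
  abs_le_one e ω := by
    have hp0 : 0 ≤ p := hp e ▸ measureReal_nonneg
    have hp1 : p ≤ 1 := hp e ▸ measureReal_le_one
    by_cases h : ω ∈ X e <;> simp only [h, not_false_eq_true, Set.indicator_of_mem,
      Set.indicator_of_notMem, Pi.one_apply, abs_le] <;> constructor <;> linarith
  integral_eq_zero e := by
    rw [integral_sub ((integrable_const 1).indicator (hX e)) (integrable_const _)]
    simp [integral_indicator_one (hX e), hp e]
  integral_sq_le e := by
    have := integral_indicator_sub_sq (μ := μ) (hX e)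
    rw [hp e] at this
    rw [this]
    nlinarith [sq_nonneg p]
  iIndepFun T hT := ((hindep T hT).iIndepFun_indicator (β := ℝ)).comp
    (fun _ z => z - p) fun _ => by fun_prop

end CentredIndicator

section EdgeExpander

variable {V : Type u} [DecidableEq V] {Q : Finset (Sym2 V)} {S A : Finset V} {D φ : ℝ}

/-- The degree of `v` in the graph with edge set `Q`. -/
def edgeDegree (Q : Finset (Sym2 V)) (v : V) : ℕ := (Q.filter (v ∈ ·)).card

/-- The boundary of `A` in the graph with edge set `Q`: the edges with exactly one end in `A`. -/
def edgeCut (Q : Finset (Sym2 V)) (A : Finset V) : Finset (Sym2 V) :=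
  Q.filter fun e => (∃ v ∈ A, v ∈ e) ∧ e ∉ A.sym2

/-- The edges `Q` form a graph on the vertex set `S` of minimum degree at least `D` and conductance
at least `φ`. -/
structure IsEdgeExpander (Q : Finset (Sym2 V)) (S : Finset V) (D φ : ℝ) : Prop where
  subset_sym2 : Q ⊆ S.sym2
  le_edgeDegree : ∀ v ∈ S, D ≤ edgeDegree Q v
  le_card_edgeCut : ∀ A ⊆ S, A.Nonempty → 2 * A.card ≤ S.card →
    φ * ∑ v ∈ A, (edgeDegree Q v : ℝ) ≤ (edgeCut Q A).card

lemma mk_mem_edgeCut {x y : V} :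
    s(x, y) ∈ edgeCut Q A ↔ s(x, y) ∈ Q ∧ ¬(x ∈ A ↔ y ∈ A) := by
  have hmem : (∃ v ∈ A, v ∈ s(x, y)) ↔ x ∈ A ∨ y ∈ A := by
    simp only [Sym2.mem_iff, and_or_left, exists_or, exists_eq_right]
  rw [edgeCut, Finset.mem_filter, hmem, Finset.mk_mem_sym2_iff]
  tauto

lemma edgeCut_sdiff (hQ : Q ⊆ S.sym2) : edgeCut Q (S \ A) = edgeCut Q A := by
  ext ⟨x, y⟩
  simp only [mk_mem_edgeCut, Finset.mem_sdiff]
  refine and_congr_right fun he => ?_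
  obtain ⟨hx, hy⟩ := Finset.mk_mem_sym2_iff.1 (hQ he)
  tauto

lemma exists_forall_mem_edgeCut_notMem {R : Set (Sym2 V)} {a b : V} (hQ : Q ⊆ S.sym2) (ha : a ∈ S)
    (hb : b ∈ S) (hab : ¬(SimpleGraph.fromEdgeSet (↑Q ∩ R)).Reachable a b) :
    ∃ A ⊆ S, A.Nonempty ∧ 2 * A.card ≤ S.card ∧ ∀ e ∈ edgeCut Q A, e ∉ R := by
  classical
  set K := SimpleGraph.fromEdgeSet (↑Q ∩ R)
  set A := S.filter (K.Reachable a)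
  have hcut : ∀ e ∈ edgeCut Q A, e ∉ R := by
    rintro ⟨x, y⟩ he hR
    obtain ⟨heQ, hxy⟩ := mk_mem_edgeCut.1 he
    obtain ⟨hx, hy⟩ := Finset.mk_mem_sym2_iff.1 (hQ heQ)
    have hne : x ≠ y := by
      rintro rfl
      exact hxy Iff.rfl
    have hadj : K.Adj x y := (SimpleGraph.fromEdgeSet_adj _).2 ⟨⟨heQ, hR⟩, hne⟩
    refine hxy ?_
    simp only [A, Finset.mem_filter, hx, hy, true_and]
    exact ⟨fun h => h.trans hadj.reachable, fun h => h.trans hadj.symm.reachable⟩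
  rcases le_total (2 * A.card) S.card with hle | hge
  · exact ⟨A, Finset.filter_subset _ _, ⟨a, Finset.mem_filter.2 ⟨ha, .refl a⟩⟩, hle, hcut⟩
  · refine ⟨S \ A, Finset.sdiff_subset, ⟨b, Finset.mem_sdiff.2 ⟨hb, ?_⟩⟩, ?_, ?_⟩
    · exact fun h => hab (Finset.mem_filter.1 h).2
    · have : (S \ A).card + A.card = S.card :=
        Finset.card_sdiff_add_card_eq_card (Finset.filter_subset _ _)
      omega
    · rwa [edgeCut_sdiff hQ]

/-- The row of `e` in the vertex-edge incidence matrix, for the orientation chosen by `Quot.out`. -/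
noncomputable def signedIncidence (e : Sym2 V) : V → ℝ :=
  Pi.single (Quot.out e).1 1 - Pi.single (Quot.out e).2 1

/-- The incidence matrix of the graph with edge set `Q`, each column divided by the square root of
the degree. Weighting its rows by the edges of a subgraph, `Bᵀ * diagonal y * B` is the normalized
Laplacian of that subgraph. -/
noncomputable def normIncidence (Q : Finset (Sym2 V)) : Matrix Q V ℝ :=
  .of fun e v => signedIncidence (e : Sym2 V) v / √(edgeDegree Q v)

/-- The test vector detecting the cut of `A`: the indicator of `A` multiplied by the square root of
the degree. -/
noncomputable def sqrtDegreeIndicator (Q : Finset (Sym2 V)) (A : Finset V) (v : V) : ℝ :=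
  if v ∈ A then √(edgeDegree Q v) else 0

lemma signedIncidence_of_notMem {e : Sym2 V} {v : V} (hv : v ∉ e) : signedIncidence e v = 0 := by
  have hfst : v ≠ (Quot.out e).1 := fun h => hv (h ▸ e.out_fst_mem)
  have hsnd : v ≠ (Quot.out e).2 := fun h => hv (h ▸ e.out_snd_mem)
  simp [signedIncidence, hfst, hsnd]

lemma abs_signedIncidence_le_one (e : Sym2 V) (v : V) : |signedIncidence e v| ≤ 1 := by
  by_cases hfst : v = (Quot.out e).1 <;> by_cases hsnd : v = (Quot.out e).2 <;>
    simp [signedIncidence, Pi.single_apply, hfst, hsnd] <;> split_ifs <;> simp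

lemma card_toFinset_le_two (e : Sym2 V) : e.toFinset.card ≤ 2 := by
  rw [Sym2.card_toFinset]
  split_ifs <;> norm_num

variable [Fintype V]

lemma abs_normIncidence_mul_transpose_le (e f : Q) :
    |(normIncidence Q * (normIncidence Q)ᵀ) e f| ≤
      ∑ v ∈ (f : Sym2 V).toFinset, if v ∈ (e : Sym2 V) then (edgeDegree Q v : ℝ)⁻¹ else 0 := by
  have hterm : ∀ v, |normIncidence Q e v * normIncidence Q f v| =
      |signedIncidence (e : Sym2 V) v| * |signedIncidence (f : Sym2 V) v| *
        (edgeDegree Q v : ℝ)⁻¹ := fun v => by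
    simp only [normIncidence, Matrix.of_apply]
    rw [div_mul_div_comm, Real.mul_self_sqrt (Nat.cast_nonneg _), abs_div, abs_mul, Nat.abs_cast,
      div_eq_mul_inv]
  calc |(normIncidence Q * (normIncidence Q)ᵀ) e f|
      ≤ ∑ v, |normIncidence Q e v * normIncidence Q f v| := Finset.abs_sum_le_sum_abs _ _
    _ = ∑ v ∈ (f : Sym2 V).toFinset, |normIncidence Q e v * normIncidence Q f v| := by
        refine (Finset.sum_subset (Finset.subset_univ _) fun v _ hv => ?_).symm
        rw [hterm, signedIncidence_of_notMem (mt Sym2.mem_toFinset.2 hv), abs_zero, mul_zero,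
          zero_mul]
    _ ≤ _ := by
        refine Finset.sum_le_sum fun v _ => ?_
        rw [hterm]
        split_ifs with hv
        · exact mul_le_of_le_one_left (by positivity) (mul_le_one₀
            (abs_signedIncidence_le_one _ _) (abs_nonneg _) (abs_signedIncidence_le_one _ _))
        · rw [signedIncidence_of_notMem hv, abs_zero, zero_mul, zero_mul]

lemma IsEdgeExpander.abs_normIncidence_mul_transpose_le (hQ : IsEdgeExpander Q S D φ) (hD : 0 < D)
    (e f : Q) : |(normIncidence Q * (normIncidence Q)ᵀ) e f| ≤ 2 * D⁻¹ := by
  refine (_root_.abs_normIncidence_mul_transpose_le e f).trans ?_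
  calc _ ≤ ∑ _v ∈ (f : Sym2 V).toFinset, D⁻¹ := Finset.sum_le_sum fun v hv => by
        have hvS : v ∈ S := Finset.mem_sym2_iff.1 (hQ.subset_sym2 f.2) v (Sym2.mem_toFinset.1 hv)
        split_ifs
        · exact inv_anti₀ hD (hQ.le_edgeDegree v hvS)
        · positivity
    _ ≤ 2 * D⁻¹ := by
        rw [Finset.sum_const, nsmul_eq_mul]
        gcongr
        exact_mod_cast card_toFinset_le_two _

lemma sum_abs_normIncidence_mul_transpose_le (f : Q) :
    ∑ e, |(normIncidence Q * (normIncidence Q)ᵀ) e f| ≤ 2 := by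
  refine (Finset.sum_le_sum fun e _ => abs_normIncidence_mul_transpose_le e f).trans ?_
  rw [Finset.sum_comm]
  calc _ ≤ ∑ _v ∈ (f : Sym2 V).toFinset, (1 : ℝ) := Finset.sum_le_sum fun v _ => by
        rw [Finset.sum_coe_sort Q fun e => if v ∈ e then (edgeDegree Q v : ℝ)⁻¹ else 0,
          ← Finset.sum_filter, Finset.sum_const, nsmul_eq_mul]
        exact mul_inv_le_one
    _ ≤ 2 := by
        rw [Finset.sum_const, nsmul_one]
        exact_mod_cast card_toFinset_le_two _

lemma sqrtDegreeIndicator_dotProduct_self :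
    sqrtDegreeIndicator Q A ⬝ᵥ sqrtDegreeIndicator Q A = ∑ v ∈ A, (edgeDegree Q v : ℝ) := by
  simp [dotProduct, sqrtDegreeIndicator]

lemma normIncidence_mulVec_sqrtDegreeIndicator (e : Q) :
    (normIncidence Q *ᵥ sqrtDegreeIndicator Q A) e =
      (if (Quot.out (e : Sym2 V)).1 ∈ A then 1 else 0) -
        (if (Quot.out (e : Sym2 V)).2 ∈ A then 1 else 0) := by
  have hterm : ∀ v, normIncidence Q e v * sqrtDegreeIndicator Q A v =
      signedIncidence (e : Sym2 V) v * (if v ∈ A then 1 else 0) := fun v => by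
    by_cases hv : v ∈ (e : Sym2 V)
    · have hdeg : 0 < edgeDegree Q v := Finset.card_pos.2 ⟨e, Finset.mem_filter.2 ⟨e.2, hv⟩⟩
      have hsqrt : √(edgeDegree Q v : ℝ) ≠ 0 := by positivity
      by_cases hA : v ∈ A <;> simp [normIncidence, sqrtDegreeIndicator, hA, hsqrt]
    · simp [normIncidence, signedIncidence_of_notMem hv]
  simp [Matrix.mulVec, dotProduct, hterm, signedIncidence, Pi.single_apply]

lemma sq_normIncidence_mulVec_sqrtDegreeIndicator (e : Q) :
    (normIncidence Q *ᵥ sqrtDegreeIndicator Q A) e ^ 2 =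
      if (e : Sym2 V) ∈ edgeCut Q A then 1 else 0 := by
  have hmem : (e : Sym2 V) ∈ edgeCut Q A ↔
      ¬((Quot.out (e : Sym2 V)).1 ∈ A ↔ (Quot.out (e : Sym2 V)).2 ∈ A) := by
    have hout : s((Quot.out (e : Sym2 V)).1, (Quot.out (e : Sym2 V)).2) = e := Quot.out_eq _
    have := mk_mem_edgeCut (Q := Q) (A := A) (x := (Quot.out (e : Sym2 V)).1)
      (y := (Quot.out (e : Sym2 V)).2)
    rwa [hout, and_iff_right e.2] at this
  rw [normIncidence_mulVec_sqrtDegreeIndicator]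
  by_cases hfst : (Quot.out (e : Sym2 V)).1 ∈ A <;>
    by_cases hsnd : (Quot.out (e : Sym2 V)).2 ∈ A <;> simp [hmem, hfst, hsnd]

lemma dotProduct_sqrtDegreeIndicator_mulVec {y : Q → ℝ} {c : ℝ}
    (hy : ∀ e : Q, (e : Sym2 V) ∈ edgeCut Q A → y e = c) :
    sqrtDegreeIndicator Q A ⬝ᵥ ((normIncidence Q)ᵀ * Matrix.diagonal y * normIncidence Q) *ᵥ
      sqrtDegreeIndicator Q A = c * (edgeCut Q A).card := by
  rw [dotProduct_transpose_mul_diagonal_mul_mulVec]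
  calc _ = ∑ e : Q, if (e : Sym2 V) ∈ edgeCut Q A then c else 0 :=
        Finset.sum_congr rfl fun e _ => by
          rw [sq_normIncidence_mulVec_sqrtDegreeIndicator]
          split_ifs with he
          · rw [hy e he, mul_one]
          · rw [mul_zero]
    _ = c * (edgeCut Q A).card := by
        rw [Finset.sum_coe_sort Q fun e => if e ∈ edgeCut Q A then c else 0, Finset.sum_ite_mem,
          Finset.inter_eq_right.2 (show edgeCut Q A ⊆ Q from Finset.filter_subset _ _),
          Finset.sum_const, nsmul_eq_mul, mul_comm]

end EdgeExpander

section SampledExpander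

variable {V : Type u} {Ω : Type v} [MeasurableSpace Ω] {μ : Measure Ω} [IsProbabilityMeasure μ]
  {G : SimpleGraph V} {p : ℝ} {k : ℕ} {H : Ω → SimpleGraph V} {Q : Finset (Sym2 V)}

lemma IsKWiseSample.isKWiseNoise (hH : IsKWiseSample μ G p k H)
    (hQG : (Q : Set (Sym2 V)) ⊆ G.edgeSet) :
    IsKWiseNoise μ p k fun (e : Q) ω =>
      {ω | (e : Sym2 V) ∈ (H ω).edgeSet}.indicator 1 ω - p := by
  refine isKWiseNoise_indicator_sub (fun e => hH.measurableSet e (hQG e.2))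
    (fun e => hH.prob e (hQG e.2)) fun T hT => ?_
  have hindep := hH.indep (T.map (.subtype _)) (fun e he => hQG (by
    obtain ⟨e', -, rfl⟩ := Finset.mem_map.1 he
    exact e'.2)) (by rwa [Finset.card_map])
  exact hindep.precomp (g := fun e : T => ⟨e, Finset.mem_map_of_mem _ e.2⟩)
    fun e e' h => Subtype.ext (Subtype.ext (Subtype.mk.inj h))

theorem IsEdgeExpander.measureReal_not_reachable_le [Finite V] [DecidableEq V] {S : Finset V}
    {D φ : ℝ} {r : ℕ} (hQ : IsEdgeExpander Q S D φ) (hH : IsKWiseSample μ G p k H)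
    (hQG : (Q : Set (Sym2 V)) ⊆ G.edgeSet) (hp : 0 < p) (hφ : 0 < φ) (hpD : 1 ≤ p * D) (hr : r ≠ 0)
    (hk : 2 * r ≤ k) :
    μ.real {ω | ∃ a ∈ S, ∃ b ∈ S,
        ¬(SimpleGraph.fromEdgeSet (↑Q ∩ (H ω).edgeSet)).Reachable a b} ≤
      Q.card * (2 * r).factorial * (4 / (p * D * φ ^ 2)) ^ r := by
  cases nonempty_fintype V
  have hD : 0 < D := pos_of_mul_pos_right (one_pos.trans_le hpD) hp.le
  have hδp : D⁻¹ ≤ p := by rwa [inv_le_iff_one_le_mul₀ hD]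
  have htrace := (hH.isKWiseNoise hQG).measureReal_exists_le_abs_dotProduct_mulVec_le
    (inv_pos.2 hD) hδp zero_le_two (mul_pos hp hφ) (hQ.abs_normIncidence_mul_transpose_le hD)
    sum_abs_normIncidence_mul_transpose_le hr hk
  have hbase : 2 ^ 2 * p * D⁻¹ / (p * φ) ^ 2 = 4 / (p * D * φ ^ 2) := by
    field_simp
    norm_num
  rw [hbase, Fintype.card_coe] at htrace
  refine (measureReal_mono ?_).trans htrace
  rintro ω ⟨a, ha, b, hb, hab⟩
  obtain ⟨A, hAS, hA, hcard, hcut⟩ :=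
    exists_forall_mem_edgeCut_notMem hQ.subset_sym2 ha hb hab
  refine ⟨sqrtDegreeIndicator Q A, ?_, ?_⟩
  · rw [sqrtDegreeIndicator_dotProduct_self]
    exact Finset.sum_pos (fun v hv => hD.trans_le (hQ.le_edgeDegree v (hAS hv))) hA
  · rw [sqrtDegreeIndicator_dotProduct_self, dotProduct_sqrtDegreeIndicator_mulVec (c := -p)
      fun e he => by simp [hcut e he], neg_mul, abs_neg, abs_of_nonneg (by positivity), mul_assoc]
    gcongr
    exact hQ.le_card_edgeCut A hAS hA hcard

end SampledExpander

section DenseSets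

/-- The number of edges that forces `m` vertices to span an expander of minimum degree `D`. The
function of `m` is superadditive with a margin of `2 * D` per vertex of the smaller part, see
`edgeThreshold_add_le`. -/
noncomputable def edgeThreshold (D : ℝ) (m : ℕ) : ℝ := 2 * D * (m * (1 + Real.logb 2 m))

/-- The vertex set `S` spans more than `edgeThreshold D S.card` edges of `B`. -/
def IsDenseOn {V : Type u} [DecidableEq V] (B : Finset (Sym2 V)) (D : ℝ) (S : Finset V) : Prop :=
  edgeThreshold D S.card < (B ∩ S.sym2).card

lemma logb_two_natCast_nonneg (m : ℕ) : 0 ≤ Real.logb 2 m := by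
  rw [← Real.log_div_log]
  positivity

lemma logb_two_natCast_mono : Monotone fun m : ℕ => Real.logb 2 m := by
  intro a b hab
  rcases a.eq_zero_or_pos with rfl | ha
  · simpa using logb_two_natCast_nonneg b
  · exact Real.logb_le_logb_of_le one_lt_two (by positivity) (by exact_mod_cast hab)

lemma edgeThreshold_nonneg {D : ℝ} (hD : 0 ≤ D) (m : ℕ) : 0 ≤ edgeThreshold D m := by
  have := logb_two_natCast_nonneg m
  unfold edgeThreshold
  positivity

lemma edgeThreshold_add_le {D : ℝ} (hD : 0 ≤ D) {a b : ℕ} (ha : a ≠ 0) (hab : a ≤ b) :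
    edgeThreshold D a + edgeThreshold D b + 2 * D * a ≤ edgeThreshold D (a + b) := by
  have hloga : 1 + Real.logb 2 a ≤ Real.logb 2 (a + b : ℕ) := by
    have hdouble : 1 + Real.logb 2 a = Real.logb 2 (2 * a : ℕ) := by
      rw [Nat.cast_mul, Real.logb_mul (by norm_num) (by exact_mod_cast ha), Nat.cast_ofNat,
        Real.logb_self_eq_one one_lt_two]
    rw [hdouble]
    exact logb_two_natCast_mono (by omega)
  have hlogb : Real.logb 2 b ≤ Real.logb 2 (a + b : ℕ) := logb_two_natCast_mono (by omega)
  calc edgeThreshold D a + edgeThreshold D b + 2 * D * a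
      ≤ 2 * D * (a * Real.logb 2 (a + b : ℕ)) + 2 * D * (b * (1 + Real.logb 2 (a + b : ℕ))) +
          2 * D * a := by
        unfold edgeThreshold
        gcongr
    _ = edgeThreshold D (a + b) := by
        unfold edgeThreshold
        push_cast
        ring

variable {V : Type u} [DecidableEq V] {B : Finset (Sym2 V)} {S A : Finset V} {D : ℝ}

lemma card_inter_sym2_le (B : Finset (Sym2 V)) (S A : Finset V) :
    (B ∩ S.sym2).card ≤
      (B ∩ A.sym2).card + (B ∩ (S \ A).sym2).card + (edgeCut (B ∩ S.sym2) A).card := by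
  have hcover :
      B ∩ S.sym2 ⊆ B ∩ A.sym2 ∪ B ∩ (S \ A).sym2 ∪ edgeCut (B ∩ S.sym2) A := by
    rintro ⟨x, y⟩
    simp only [Finset.mem_union, Finset.mem_inter, mk_mem_edgeCut, Finset.mk_mem_sym2_iff,
      Finset.mem_sdiff]
    tauto
  exact (Finset.card_le_card hcover).trans ((Finset.card_union_le _ _).trans
    (Nat.add_le_add_right (Finset.card_union_le _ _) _))

lemma sum_edgeDegree_le (Q : Finset (Sym2 V)) (A : Finset V) :
    ∑ v ∈ A, edgeDegree Q v ≤ 2 * (Q ∩ A.sym2).card + (edgeCut Q A).card := by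
  have hcount : ∀ x y : V, (A.filter (· ∈ s(x, y))).card ≤
      2 * (if s(x, y) ∈ A.sym2 then 1 else 0) + if ¬(x ∈ A ↔ y ∈ A) then 1 else 0 := by
    intro x y
    have hfilter : A.filter (· ∈ s(x, y)) = ({x, y} : Finset V).filter (· ∈ A) := by
      ext v
      simp [and_comm]
    rw [hfilter, Finset.filter_insert, Finset.filter_singleton]
    have hcard := Finset.card_le_two (a := x) (b := y)
    by_cases hx : x ∈ A <;> by_cases hy : y ∈ A <;> simp [hx, hy, hcard]
  calc ∑ v ∈ A, edgeDegree Q v = ∑ e ∈ Q, (A.filter (· ∈ e)).card :=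
        Finset.sum_card_bipartiteAbove_eq_sum_card_bipartiteBelow (· ∈ ·)
    _ ≤ ∑ e ∈ Q, (2 * (if e ∈ A.sym2 then 1 else 0) + if e ∈ edgeCut Q A then 1 else 0) := by
        refine Finset.sum_le_sum fun e he => ?_
        induction e with
        | h x y => simpa only [mk_mem_edgeCut, he, true_and] using hcount x y
    _ = 2 * (Q ∩ A.sym2).card + (edgeCut Q A).card := by
        rw [Finset.sum_add_distrib, ← Finset.mul_sum, ← Finset.card_filter, ← Finset.card_filter,
          Finset.filter_mem_eq_inter, Finset.filter_mem_eq_inter,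
          Finset.inter_eq_right.2 (show edgeCut Q A ⊆ Q from Finset.filter_subset _ _)]

lemma card_inter_sym2_le_edgeThreshold (hS : Minimal (IsDenseOn B D) S) (hA : A ⊂ S) :
    (B ∩ A.sym2).card ≤ edgeThreshold D A.card :=
  not_lt.1 (hS.not_prop_of_lt hA)

lemma card_inter_sym2_le_mul_logb (hS : Minimal (IsDenseOn B D) S) (hD : 0 ≤ D) (hA : A ⊂ S) :
    ((B ∩ A.sym2).card : ℝ) ≤ 2 * (D * A.card) * (1 + Real.logb 2 S.card) := by
  have hlog : Real.logb 2 A.card ≤ Real.logb 2 S.card :=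
    logb_two_natCast_mono (Finset.card_le_card hA.subset)
  calc ((B ∩ A.sym2).card : ℝ) ≤ edgeThreshold D A.card := card_inter_sym2_le_edgeThreshold hS hA
    _ = 2 * (D * A.card) * (1 + Real.logb 2 A.card) := by
        unfold edgeThreshold
        ring
    _ ≤ 2 * (D * A.card) * (1 + Real.logb 2 S.card) := by gcongr

/-- Splitting `S` into `A` and `S \ A` loses few edges inside the parts, by minimality, and so the
superadditivity of the threshold must be accounted for by the cut. -/
lemma two_mul_card_le_card_edgeCut (hS : Minimal (IsDenseOn B D) S) (hD : 0 ≤ D) (hAS : A ⊆ S)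
    (hA : A.Nonempty) (hcard : 2 * A.card ≤ S.card) :
    2 * D * A.card ≤ (edgeCut (B ∩ S.sym2) A).card := by
  have hApos := hA.card_pos
  have hadd : (S \ A).card + A.card = S.card := Finset.card_sdiff_add_card_eq_card hAS
  have hA_le := card_inter_sym2_le_edgeThreshold hS
    (hAS.ssubset_of_ne (by rintro rfl; omega))
  have hdiff_le := card_inter_sym2_le_edgeThreshold hS (Finset.sdiff_ssubset hAS hA)
  have hsplit : ((B ∩ S.sym2).card : ℝ) ≤
      (B ∩ A.sym2).card + (B ∩ (S \ A).sym2).card + (edgeCut (B ∩ S.sym2) A).card := by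
    exact_mod_cast card_inter_sym2_le B S A
  have hdense : edgeThreshold D S.card < (B ∩ S.sym2).card := hS.prop
  have hsuper := edgeThreshold_add_le hD hApos.ne' (b := (S \ A).card) (by omega)
  rw [add_comm A.card, hadd] at hsuper
  linarith

lemma card_le_card_edgeCut_erase (hS : Minimal (IsDenseOn B D) S) (hD : 1 ≤ D) (hAS : A ⊆ S)
    (hA : A.Nonempty) (hcard : 2 * A.card ≤ S.card) (e : Sym2 V) :
    D * A.card ≤ (edgeCut ((B ∩ S.sym2).erase e) A).card := by
  have herase : (edgeCut (B ∩ S.sym2) A).card ≤ (edgeCut ((B ∩ S.sym2).erase e) A).card + 1 := by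
    rw [edgeCut, edgeCut, Finset.filter_erase]
    have := Finset.pred_card_le_card_erase (s := edgeCut (B ∩ S.sym2) A) (a := e)
    unfold edgeCut at this
    omega
  have hcut := two_mul_card_le_card_edgeCut hS (zero_le_one.trans hD) hAS hA hcard
  have herase' : ((edgeCut (B ∩ S.sym2) A).card : ℝ) ≤
      (edgeCut ((B ∩ S.sym2).erase e) A).card + 1 := by exact_mod_cast herase
  have hone : 1 ≤ D * A.card :=
    one_le_mul_of_one_le_of_one_le hD (by exact_mod_cast hA.card_pos)
  linarith

lemma IsDenseOn.two_le_card (hS : IsDenseOn B D S) (hD : 1 ≤ D) : 2 ≤ S.card := by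
  by_contra! hlt
  have hcard : (B ∩ S.sym2).card ≤ S.card := by
    refine (Finset.card_le_card Finset.inter_subset_right).trans ?_
    rw [Finset.card_sym2]
    interval_cases S.card <;> norm_num [Nat.choose]
  have hthr : (S.card : ℝ) ≤ edgeThreshold D S.card := by
    unfold edgeThreshold
    interval_cases S.card <;> norm_num
    linarith
  have hcard' : ((B ∩ S.sym2).card : ℝ) ≤ S.card := by exact_mod_cast hcard
  exact absurd hS (not_lt.2 (hcard'.trans hthr))

theorem isEdgeExpander_erase_of_minimal (hS : Minimal (IsDenseOn B D) S) (hD : 1 ≤ D)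
    (e : Sym2 V) :
    IsEdgeExpander ((B ∩ S.sym2).erase e) S D (1 / (5 + 4 * Real.logb 2 S.card)) := by
  set Q := (B ∩ S.sym2).erase e
  refine ⟨(Finset.erase_subset _ _).trans Finset.inter_subset_right, fun v hv => ?_,
    fun A hAS hA hcard => ?_⟩
  · have hcut := card_le_card_edgeCut_erase hS hD (Finset.singleton_subset_iff.2 hv)
      (Finset.singleton_nonempty v) (by simpa using hS.prop.two_le_card hD) e
    rw [Finset.card_singleton, Nat.cast_one, mul_one] at hcut
    refine hcut.trans (Nat.cast_le.2 (Finset.card_le_card ?_))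
    exact Finset.monotone_filter_right _ fun f _ hf => by simpa using hf.1
  · have hApos := hA.card_pos
    have hcut : D * A.card ≤ (edgeCut Q A).card :=
      card_le_card_edgeCut_erase hS hD hAS hA hcard e
    have hinside : ((Q ∩ A.sym2).card : ℝ) ≤ 2 * (D * A.card) * (1 + Real.logb 2 S.card) := by
      have hQB : Q ∩ A.sym2 ⊆ B ∩ A.sym2 := Finset.inter_subset_inter_right
        ((Finset.erase_subset _ _).trans Finset.inter_subset_left)
      exact (Nat.cast_le.2 (Finset.card_le_card hQB)).trans (card_inter_sym2_le_mul_logb hS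
        (zero_le_one.trans hD) (hAS.ssubset_of_ne (by rintro rfl; omega)))
    have hvol : ∑ v ∈ A, (edgeDegree Q v : ℝ) ≤ 2 * (Q ∩ A.sym2).card + (edgeCut Q A).card := by
      exact_mod_cast sum_edgeDegree_le Q A
    have hlog := logb_two_natCast_nonneg S.card
    rw [one_div, inv_mul_le_iff₀ (by positivity)]
    calc _ ≤ 4 * (1 + Real.logb 2 S.card) * (D * A.card) + (edgeCut Q A).card := by linarith
      _ ≤ 4 * (1 + Real.logb 2 S.card) * (edgeCut Q A).card + (edgeCut Q A).card := by gcongr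
      _ = (5 + 4 * Real.logb 2 S.card) * (edgeCut Q A).card := by ring

lemma IsEdgeExpander.mono {Q : Finset (Sym2 V)} {φ ψ : ℝ} (hQ : IsEdgeExpander Q S D φ)
    (hψ : ψ ≤ φ) : IsEdgeExpander Q S D ψ where
  subset_sym2 := hQ.subset_sym2
  le_edgeDegree := hQ.le_edgeDegree
  le_card_edgeCut A hAS hA hcard :=
    (mul_le_mul_of_nonneg_right hψ (by positivity)).trans (hQ.le_card_edgeCut A hAS hA hcard)

/-- The edge `e` lies in the vertex set of an expander consisting of lighter edges of `G`. -/
def IsExpanderSpanned {α : Type*} [LT α] (w : Sym2 V → α) (G : SimpleGraph V) (D φ : ℝ)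
    (e : Sym2 V) : Prop :=
  ∃ (Q : Finset (Sym2 V)) (S : Finset V), (Q : Set (Sym2 V)) ⊆ G.edgeSet ∧
    (∀ f ∈ Q, w f < w e) ∧ e ∈ S.sym2 ∧ IsEdgeExpander Q S D φ

theorem ncard_not_isExpanderSpanned_le [Fintype V] {α : Type*} [LinearOrder α] {w : Sym2 V → α}
    {G : SimpleGraph V} (hw : Set.InjOn w G.edgeSet) (hD : 1 ≤ D) :
    ({e ∈ G.edgeSet | ¬IsExpanderSpanned w G D
        (1 / (5 + 4 * Real.logb 2 (Fintype.card V))) e}.ncard : ℝ) ≤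
      edgeThreshold D (Fintype.card V) := by
  set φ := 1 / (5 + 4 * Real.logb 2 (Fintype.card V))
  obtain ⟨B, hB⟩ := (Set.toFinite {e ∈ G.edgeSet | ¬IsExpanderSpanned w G D φ e}).exists_finset_coe
  rw [← hB, Set.ncard_coe_finset]
  by_contra! hlt
  have hBG : (B : Set (Sym2 V)) ⊆ G.edgeSet := hB ▸ Set.sep_subset _ _
  obtain ⟨S, -, hS⟩ := exists_minimal_le_of_wellFoundedLT (IsDenseOn B D) Finset.univ
    (by simpa [IsDenseOn] using hlt)
  have hne : (B ∩ S.sym2).Nonempty := by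
    rw [← Finset.card_pos, ← Nat.cast_pos (α := ℝ)]
    exact (edgeThreshold_nonneg (zero_le_one.trans hD) _).trans_lt hS.prop
  obtain ⟨e, he, hmax⟩ := (B ∩ S.sym2).exists_max_image w hne
  obtain ⟨heB, heS⟩ := Finset.mem_inter.1 he
  have hsub : (B ∩ S.sym2).erase e ⊆ B := (Finset.erase_subset _ _).trans Finset.inter_subset_left
  have hnot : e ∈ {e ∈ G.edgeSet | ¬IsExpanderSpanned w G D φ e} := hB ▸ heB
  refine hnot.2 ⟨(B ∩ S.sym2).erase e, S, fun f hf => hBG (hsub hf), fun f hf => ?_, heS,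
    (isEdgeExpander_erase_of_minimal hS hD e).mono ?_⟩
  · obtain ⟨hfe, hf'⟩ := Finset.mem_erase.1 hf
    exact (hmax f hf').lt_of_ne fun h => hfe (hw (hBG (hsub hf)) (hBG heB) h)
  · have hlogS := logb_two_natCast_nonneg S.card
    have : Real.logb 2 S.card ≤ Real.logb 2 (Fintype.card V) :=
      logb_two_natCast_mono (Finset.card_le_univ S)
    exact one_div_le_one_div_of_le (by positivity) (by linarith)

end DenseSets

section MinWeightForest

variable {V : Type u} {H K F : SimpleGraph V} {a b x y : V}

lemma reachable_of_forall_adj (h : ∀ x y, K.Adj x y → F.Reachable x y) (hxy : K.Reachable x y) :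
    F.Reachable x y := by
  rw [SimpleGraph.reachable_iff_reflTransGen] at hxy ⊢
  exact Relation.reflTransGen_closed
    (fun c d hcd => (SimpleGraph.reachable_iff_reflTransGen c d).1 (h c d hcd)) _ _ hxy

lemma exists_reachable_end_of_sup_edge (hxy : (K ⊔ SimpleGraph.edge a b).Reachable x y)
    (hK : ¬K.Reachable x y) : ∃ z ∈ s(a, b), K.Reachable x z := by
  obtain ⟨q⟩ := hxy
  obtain ⟨d, -, hfst, hsnd⟩ := q.exists_boundary_dart {z | K.Reachable x z} (.refl x) hK
  refine ⟨d.fst, ?_, hfst⟩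
  rcases d.adj with hadj | hadj
  · exact absurd (SimpleGraph.Reachable.trans hfst hadj.reachable) hsnd
  · rcases (SimpleGraph.edge_adj ..).1 hadj with ⟨⟨h, -⟩ | ⟨h, -⟩, -⟩ <;> simp [h]

lemma reachable_sup_edge_exchange (hxy : (K ⊔ SimpleGraph.edge a b).Reachable x y)
    (hK : ¬K.Reachable x y) : (K ⊔ SimpleGraph.edge x y).Reachable a b := by
  obtain ⟨z, hz, hxz⟩ := exists_reachable_end_of_sup_edge hxy hK
  obtain ⟨z', hz', hyz'⟩ := exists_reachable_end_of_sup_edge hxy.symm fun h => hK h.symm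
  have hne : z ≠ z' := by
    rintro rfl
    exact hK (hxz.trans hyz'.symm)
  have hxy' : (K ⊔ SimpleGraph.edge x y).Reachable x y := by
    have hadj : (SimpleGraph.edge x y).Adj x y :=
      (SimpleGraph.edge_adj ..).2 ⟨.inl ⟨rfl, rfl⟩, fun h => hK (h ▸ .refl x)⟩
    exact hadj.reachable.mono le_sup_right
  have hzz' : (K ⊔ SimpleGraph.edge x y).Reachable z z' :=
    ((hxz.mono le_sup_left).symm.trans hxy').trans (hyz'.mono le_sup_left)
  rcases Sym2.mem_iff.1 hz with rfl | rfl <;> rcases Sym2.mem_iff.1 hz' with rfl | rfl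
  · exact absurd rfl hne
  · exact hzz'
  · exact hzz'.symm
  · exact absurd rfl hne

lemma deleteEdges_sup_edge (hab : F.Adj a b) :
    F.deleteEdges {s(a, b)} ⊔ SimpleGraph.edge a b = F :=
  sdiff_sup_cancel ((SimpleGraph.edge_le_iff F).2 (.inr hab))

lemma IsMaximalForest.exchange (hF : IsMaximalForest H F) (hab : F.Adj a b) (hxy : H.Adj x y)
    (hnot : ¬(F.deleteEdges {s(a, b)}).Reachable x y) :
    IsMaximalForest H (F.deleteEdges {s(a, b)} ⊔ SimpleGraph.edge x y) := by
  set K := F.deleteEdges {s(a, b)}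
  have hKF : K ≤ F := SimpleGraph.deleteEdges_le _
  have hF_eq : K ⊔ SimpleGraph.edge a b = F := deleteEdges_sup_edge hab
  have hreach : F.Reachable = H.Reachable := SimpleGraph.reachable_eq_of_maximal_isAcyclic F hF
  have hle : K ⊔ SimpleGraph.edge x y ≤ H :=
    sup_le (hKF.trans hF.prop.1) ((SimpleGraph.edge_le_iff H).2 (.inr hxy))
  have hab' : (K ⊔ SimpleGraph.edge x y).Reachable a b :=
    reachable_sup_edge_exchange (by rw [hF_eq, hreach]; exact hxy.reachable) hnot
  refine (SimpleGraph.maximal_isAcyclic_iff_reachable_eq hle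
    ((hF.prop.2.anti hKF).sup_edge_of_not_reachable hnot)).2 ?_
  ext c d
  refine ⟨fun h => h.mono hle, fun h => ?_⟩
  rw [← hreach] at h
  refine reachable_of_forall_adj (fun c d hcd => ?_) h
  by_cases hcd' : s(c, d) = s(a, b)
  · rcases Sym2.eq_iff.1 hcd' with ⟨rfl, rfl⟩ | ⟨rfl, rfl⟩
    · exact hab'
    · exact hab'.symm
  · have hadj : K.Adj c d := SimpleGraph.deleteEdges_adj.2 ⟨hcd, hcd'⟩
    exact hadj.reachable.mono le_sup_left

lemma not_reachable_deleteEdges_of_mem_edges (hF : F.IsAcyclic) {P : F.Walk x y} (hP : P.IsPath)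
    {e : Sym2 V} (he : e ∈ P.edges) : ¬(F.deleteEdges {e}).Reachable x y := by
  intro h
  obtain ⟨q, hq⟩ := h.exists_isPath
  have hle : F.deleteEdges {e} ≤ F := SimpleGraph.deleteEdges_le _
  have hPq : P = q.mapLe hle := congrArg Subtype.val
    ((hF.subsingleton_path x y).elim ⟨P, hP⟩ ⟨_, (SimpleGraph.Walk.isPath_mapLe hle).2 hq⟩)
  rw [hPq, SimpleGraph.Walk.edges_mapLe_eq_edges] at he
  simpa using q.edges_subset_edgeSet he

lemma maxPathWeight_lt_of_isPath {w : Sym2 V → ℝ} {P : F.Walk x y} (hP : P.IsPath) {t : ℝ}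
    (ht : ∀ e ∈ P.edges, w e < t) : maxPathWeight w F x y < t := by
  classical
  refine (iInf_le _ (⟨P, hP⟩ : F.Path x y)).trans_lt ?_
  have hsup : (⨆ e ∈ P.edges, (w e : EReal)) = P.edges.toFinset.sup fun e => (w e : EReal) := by
    simp only [Finset.sup_eq_iSup, List.mem_toFinset]
  rw [hsup, Finset.sup_lt_iff (EReal.bot_lt_coe t)]
  exact fun e he => EReal.coe_lt_coe_iff.2 (ht e (List.mem_toFinset.1 he))

variable [Fintype V] {w : Sym2 V → ℝ}

lemma graphWeight_sup_edge (w : Sym2 V → ℝ) (hxy : x ≠ y) (hnadj : ¬F.Adj x y) :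
    graphWeight w (F ⊔ SimpleGraph.edge x y) = w s(x, y) + graphWeight w F := by
  rw [graphWeight, SimpleGraph.edgeSet_sup, SimpleGraph.edgeSet_edge_of_ne hxy,
    Set.union_singleton, finsum_mem_insert w hnadj (Set.toFinite _), graphWeight]

lemma IsMinWeightForest.weight_le (hF : IsMinWeightForest w H F) (hab : F.Adj a b)
    (hxy : H.Adj x y) (hnot : ¬(F.deleteEdges {s(a, b)}).Reachable x y) :
    w s(a, b) ≤ w s(x, y) := by
  have hmin := hF.2 _ (hF.1.exchange hab hxy hnot)
  rw [graphWeight_sup_edge w hxy.ne fun h => hnot h.reachable] at hmin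
  conv_lhs at hmin => rw [← deleteEdges_sup_edge hab]
  rw [graphWeight_sup_edge w hab.ne (by simp)] at hmin
  linarith

theorem IsMinWeightForest.maxPathWeight_lt (hF : IsMinWeightForest w H F) (hKH : K ≤ H) {t : ℝ}
    (ht : ∀ e ∈ K.edgeSet, w e < t) (hxy : K.Reachable x y) : maxPathWeight w F x y < t := by
  have hFxy : F.Reachable x y := by
    rw [SimpleGraph.reachable_eq_of_maximal_isAcyclic F hF.1]
    exact hxy.mono hKH
  obtain ⟨P, hP⟩ := hFxy.exists_isPath
  refine maxPathWeight_lt_of_isPath hP fun e he => ?_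
  have hsep := not_reachable_deleteEdges_of_mem_edges hF.1.prop.2 hP he
  obtain ⟨c, d, hcd, hnot⟩ : ∃ c d, K.Adj c d ∧ ¬(F.deleteEdges {e}).Reachable c d := by
    by_contra! h
    exact hsep (reachable_of_forall_adj h hxy)
  induction e with
  | h a b => exact (hF.weight_le (P.adj_of_mem_edges he) (hKH hcd) hnot).trans_lt (ht _ hcd)

end MinWeightForest

section LightEdges

variable {V : Type u} [Fintype V] {Ω : Type v} [MeasurableSpace Ω] {μ : Measure Ω}
  [IsProbabilityMeasure μ] {w : Sym2 V → ℝ} {G : SimpleGraph V} {p D φ : ℝ} {k r : ℕ}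
  {H F : Ω → SimpleGraph V}

lemma notMem_lightEdges_of_reachable {H F : SimpleGraph V}
    (hF : IsMinWeightForest w H F) {e : Sym2 V} {Q : Finset (Sym2 V)} {S : Finset V}
    (hQ : ∀ f ∈ Q, w f < w e) (he : e ∈ S.sym2)
    (hreach : ∀ a ∈ S, ∀ b ∈ S, (SimpleGraph.fromEdgeSet (↑Q ∩ H.edgeSet)).Reachable a b) :
    e ∉ lightEdges w G F := by
  induction e with
  | h a b =>
    obtain ⟨ha, hb⟩ := Finset.mk_mem_sym2_iff.1 he
    refine fun hlight => (hlight.2 a b rfl).not_gt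
      (hF.maxPathWeight_lt ?_ (fun f hf => ?_) (hreach a ha b hb))
    · intro x y hxy
      exact ((SimpleGraph.fromEdgeSet_adj _).1 hxy).1.2
    · rw [SimpleGraph.edgeSet_fromEdgeSet] at hf
      exact hQ f hf.1.1

lemma IsExpanderSpanned.measureReal_mem_lightEdges_le [DecidableEq V]
    (hH : IsKWiseSample μ G p k H) (hF : ∀ ω, IsMinWeightForest w (H ω) (F ω)) (hp : 0 < p)
    (hφ : 0 < φ) (hpD : 1 ≤ p * D) (hr : r ≠ 0) (hk : 2 * r ≤ k) {e : Sym2 V}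
    (he : IsExpanderSpanned w G D φ e) :
    μ.real {ω | e ∈ lightEdges w G (F ω)} ≤
      G.edgeSet.ncard * ((2 * r).factorial * (4 / (p * D * φ ^ 2)) ^ r) := by
  obtain ⟨Q, S, hQG, hlt, heS, hQ⟩ := he
  have hsub : {ω | e ∈ lightEdges w G (F ω)} ⊆ {ω | ∃ a ∈ S, ∃ b ∈ S,
      ¬(SimpleGraph.fromEdgeSet (↑Q ∩ (H ω).edgeSet)).Reachable a b} := by
    intro ω hω
    by_contra hreach
    simp only [Set.mem_ofPred_eq, not_exists, not_and, not_not] at hreach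
    exact notMem_lightEdges_of_reachable (hF ω) hlt heS hreach hω
  have hcard : Q.card ≤ G.edgeSet.ncard := by
    rw [← Set.ncard_coe_finset]
    exact Set.ncard_le_ncard hQG
  calc μ.real {ω | e ∈ lightEdges w G (F ω)}
      ≤ Q.card * (2 * r).factorial * (4 / (p * D * φ ^ 2)) ^ r :=
        (measureReal_mono hsub).trans (hQ.measureReal_not_reachable_le hH hQG hp hφ hpD hr hk)
    _ ≤ G.edgeSet.ncard * (2 * r).factorial * (4 / (p * D * φ ^ 2)) ^ r := by gcongr
    _ = _ := mul_assoc _ _ _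

theorem one_sub_le_measureReal_ncard_lightEdges_le_edgeThreshold (hw : Set.InjOn w G.edgeSet)
    (hH : IsKWiseSample μ G p k H) (hF : ∀ ω, IsMinWeightForest w (H ω) (F ω)) (hp : 0 < p)
    (hD : 1 ≤ D) (hpD : 1 ≤ p * D) (hr : r ≠ 0) (hk : 2 * r ≤ k)
    (hφ : φ = 1 / (5 + 4 * Real.logb 2 (Fintype.card V))) :
    1 - G.edgeSet.ncard ^ 2 * ((2 * r).factorial * (4 / (p * D * φ ^ 2)) ^ r) ≤
      μ.real {ω | ((lightEdges w G (F ω)).ncard : ℝ) ≤ edgeThreshold D (Fintype.card V)} := by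
  classical
  set q := (2 * r).factorial * (4 / (p * D * φ ^ 2)) ^ r
  have hlog := logb_two_natCast_nonneg (Fintype.card V)
  have hφ0 : 0 < φ := by rw [hφ]; positivity
  set few := {ω | ((lightEdges w G (F ω)).ncard : ℝ) ≤ edgeThreshold D (Fintype.card V)}
  set spanned := (Set.toFinite {e ∈ G.edgeSet | IsExpanderSpanned w G D φ e}).toFinset
  have hcard : spanned.card ≤ G.edgeSet.ncard := by
    rw [← Set.ncard_eq_toFinset_card]
    exact Set.ncard_le_ncard (Set.sep_subset _ _)
  have hcover : Set.univ ⊆ few ∪ ⋃ e ∈ spanned, {ω | e ∈ lightEdges w G (F ω)} := by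
    intro ω _
    by_cases hω : ∃ e ∈ spanned, e ∈ lightEdges w G (F ω)
    · exact .inr (by simpa using hω)
    · have hsub : lightEdges w G (F ω) ⊆ {e ∈ G.edgeSet | ¬IsExpanderSpanned w G D φ e} :=
        fun e he => ⟨he.1, fun hspan => hω ⟨e, (Set.Finite.mem_toFinset _).2 ⟨he.1, hspan⟩, he⟩⟩
      have hfew := ncard_not_isExpanderSpanned_le hw hD
      rw [← hφ] at hfew
      exact .inl ((Nat.cast_le.2 (Set.ncard_le_ncard hsub)).trans hfew)
  have hfail : μ.real (⋃ e ∈ spanned, {ω | e ∈ lightEdges w G (F ω)}) ≤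
      G.edgeSet.ncard ^ 2 * q := by
    calc _ ≤ ∑ e ∈ spanned, μ.real {ω | e ∈ lightEdges w G (F ω)} :=
          measureReal_biUnion_finset_le _ _
      _ ≤ ∑ _e ∈ spanned, G.edgeSet.ncard * q := Finset.sum_le_sum fun e he =>
          ((Set.Finite.mem_toFinset _).1 he).2.measureReal_mem_lightEdges_le hH hF hp hφ0 hpD hr hk
      _ ≤ G.edgeSet.ncard * (G.edgeSet.ncard * q) := by
          rw [Finset.sum_const, nsmul_eq_mul]
          gcongr
      _ = _ := by ring
  have htotal : 1 ≤ μ.real few + μ.real (⋃ e ∈ spanned, {ω | e ∈ lightEdges w G (F ω)}) := by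
    rw [← probReal_univ (μ := μ)]
    exact (measureReal_mono hcover).trans (measureReal_union_le _ _)
  linarith

lemma ncard_edgeSet_le_choose_two (G : SimpleGraph V) :
    G.edgeSet.ncard ≤ (Fintype.card V).choose 2 := by
  classical
  rw [← SimpleGraph.coe_edgeFinset, Set.ncard_coe_finset]
  exact G.card_edgeFinset_le_card_choose_two

lemma ncard_lightEdges_le_choose_two (w : Sym2 V → ℝ) (G F : SimpleGraph V) :
    (lightEdges w G F).ncard ≤ (Fintype.card V).choose 2 :=
  (Set.ncard_le_ncard (Set.sep_subset _ _)).trans (ncard_edgeSet_le_choose_two G)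

/-- The expected degree, after sampling, of the expanders of the proof, where `L` is `log n` and the
sampling is `c * L`-wise independent. The trace method with a moment of order about `c * L`
then fails with probability about `exp (-5 * L)`, see `factorial_mul_pow_le_exp`. -/
noncomputable def sampledDegree (c L : ℝ) : ℝ := 676 * c ^ 2 * Real.exp (20 / c) * L ^ 4

lemma one_le_sampledDegree {c L : ℝ} (hc : 0 < c) (hL : 1 ≤ L) (hcL : 2 ≤ c * L) :
    1 ≤ sampledDegree c L := by
  have hexp : 1 ≤ Real.exp (20 / c) := Real.one_le_exp (by positivity)
  calc (1 : ℝ) ≤ 676 * 2 ^ 2 * 1 * 1 ^ 2 := by norm_num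
    _ ≤ 676 * (c * L) ^ 2 * Real.exp (20 / c) * L ^ 2 := by gcongr
    _ = sampledDegree c L := by rw [sampledDegree]; ring

lemma factorial_mul_pow_le_exp {c L φ : ℝ} {r : ℕ} (hc : 0 < c) (hL : 0 < L)
    (hφ : 1 / (13 * L) ≤ φ) (hr_le : 2 * r ≤ c * L) (hr_ge : c * L ≤ 4 * r) :
    (2 * r).factorial * (4 / (sampledDegree c L * φ ^ 2)) ^ r ≤ Real.exp (-(5 * L)) := by
  have hd : 0 < sampledDegree c L := by unfold sampledDegree; positivity
  have hφ0 : 0 < φ := lt_of_lt_of_le (by positivity) hφ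
  have hfact : ((2 * r).factorial : ℝ) ≤ ((2 * r : ℝ) ^ 2) ^ r := by
    rw [← pow_mul]
    exact_mod_cast Nat.factorial_le_pow (2 * r)
  have hbase : (2 * r : ℝ) ^ 2 * (4 / (sampledDegree c L * φ ^ 2)) ≤ Real.exp (-(20 / c)) := by
    calc _ ≤ (c * L) ^ 2 * (4 / (sampledDegree c L * (1 / (13 * L)) ^ 2)) := by gcongr
      _ = Real.exp (-(20 / c)) := by
        rw [sampledDegree, Real.exp_neg]
        field_simp
        norm_num
  calc _ ≤ ((2 * r : ℝ) ^ 2) ^ r * (4 / (sampledDegree c L * φ ^ 2)) ^ r := by gcongr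
    _ = ((2 * r : ℝ) ^ 2 * (4 / (sampledDegree c L * φ ^ 2))) ^ r := (mul_pow _ _ _).symm
    _ ≤ Real.exp (-(20 / c)) ^ r := by gcongr
    _ = Real.exp (-(5 / c * (4 * r))) := by
        rw [← Real.exp_nat_mul]
        ring_nf
    _ ≤ Real.exp (-(5 / c * (c * L))) := by gcongr
    _ = Real.exp (-(5 * L)) := by field_simp

lemma logb_two_le_two_mul_log {x : ℝ} (hx : 1 ≤ x) : Real.logb 2 x ≤ 2 * Real.log x := by
  rw [Real.logb, div_le_iff₀ (Real.log_pos one_lt_two)]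
  nlinarith [Real.log_two_gt_d9, Real.log_nonneg hx]

lemma one_le_of_one_le_log {n : ℕ} (hn : 1 ≤ Real.log n) : (1 : ℝ) ≤ n := by
  by_contra! h
  linarith [Real.log_nonpos n.cast_nonneg h.le]

lemma edgeThreshold_le {n : ℕ} (hD : 0 ≤ D) (hn : 1 ≤ Real.log n) :
    edgeThreshold D n ≤ 6 * D * Real.log n * n := by
  have hlogb : 1 + Real.logb 2 n ≤ 3 * Real.log n := by
    linarith [logb_two_le_two_mul_log (one_le_of_one_le_log hn)]
  calc edgeThreshold D n ≤ 2 * D * (n * (3 * Real.log n)) := by unfold edgeThreshold; gcongr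
    _ = 6 * D * Real.log n * n := by ring

lemma exists_natCast_near_half {x : ℝ} (hx : 2 ≤ x) :
    ∃ r : ℕ, r ≠ 0 ∧ (2 * r : ℝ) ≤ x ∧ x ≤ 4 * r := by
  have hle : (⌊x / 2⌋₊ : ℝ) ≤ x / 2 := Nat.floor_le (by linarith)
  have hlt : x / 2 < ⌊x / 2⌋₊ + 1 := Nat.lt_floor_add_one _
  have hpos : 0 < ⌊x / 2⌋₊ := Nat.floor_pos.2 (by linarith)
  have hone : (1 : ℝ) ≤ ⌊x / 2⌋₊ := by exact_mod_cast hpos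
  exact ⟨⌊x / 2⌋₊, hpos.ne', by linarith, by linarith⟩

lemma ncard_edgeSet_sq_mul_exp_le (G : SimpleGraph V) (hn : 1 ≤ Real.log (Fintype.card V)) :
    (G.edgeSet.ncard : ℝ) ^ 2 * Real.exp (-(5 * Real.log (Fintype.card V))) ≤
      1 / Fintype.card V := by
  have hpos : (0 : ℝ) < Fintype.card V := zero_lt_one.trans_le (one_le_of_one_le_log hn)
  have hcard : (G.edgeSet.ncard : ℝ) ≤ (Fintype.card V : ℝ) ^ 2 := by
    exact_mod_cast (ncard_edgeSet_le_choose_two G).trans (Nat.choose_le_pow _ 2)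
  have hexp : Real.exp (5 * Real.log (Fintype.card V)) = (Fintype.card V : ℝ) ^ 5 := by
    rw [mul_comm, Real.exp_mul, Real.exp_log hpos]
    norm_cast
  calc _ ≤ ((Fintype.card V : ℝ) ^ 2) ^ 2 * ((Fintype.card V : ℝ) ^ 5)⁻¹ := by
        rw [Real.exp_neg, hexp]
        gcongr
    _ = 1 / Fintype.card V := by field_simp

lemma measureReal_le_mono (X : Ω → ℝ) {a b : ℝ} (hab : a ≤ b) :
    μ.real {ω | X ω ≤ a} ≤ μ.real {ω | X ω ≤ b} :=
  measureReal_mono (Set.ofPred_subset_ofPred.2 fun _ hω => hω.trans hab)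

theorem one_sub_inv_le_measureReal_ncard_lightEdges_le {c : ℝ} (hc : 0 < c)
    (hw : Set.InjOn w G.edgeSet) (hp : 0 < p) (hp1 : p ≤ 1)
    (hk : c * Real.log (Fintype.card V) ≤ k) (hH : IsKWiseSample μ G p k H)
    (hF : ∀ ω, IsMinWeightForest w (H ω) (F ω)) (hn : 1 ≤ Real.log (Fintype.card V))
    (hcn : 2 ≤ c * Real.log (Fintype.card V)) :
    1 - 1 / (Fintype.card V : ℝ) ≤ μ.real {ω | ((lightEdges w G (F ω)).ncard : ℝ) ≤
      edgeThreshold (sampledDegree c (Real.log (Fintype.card V)) / p) (Fintype.card V)} := by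
  set L := Real.log (Fintype.card V)
  set d := sampledDegree c L
  have hd : 1 ≤ d := one_le_sampledDegree hc hn hcn
  have hpd : p * (d / p) = d := mul_div_cancel₀ d hp.ne'
  have hlogb := logb_two_natCast_nonneg (Fintype.card V)
  have hφ : 1 / (13 * L) ≤ 1 / (5 + 4 * Real.logb 2 (Fintype.card V)) :=
    one_div_le_one_div_of_le (by positivity)
      (by linarith [logb_two_le_two_mul_log (one_le_of_one_le_log hn)])
  obtain ⟨r, hr, hr_le, hr_ge⟩ := exists_natCast_near_half hcn
  have hrk : 2 * r ≤ k := by exact_mod_cast hr_le.trans hk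
  have hfail := one_sub_le_measureReal_ncard_lightEdges_le_edgeThreshold hw hH hF hp
    (hd.trans (le_div_self (by positivity) hp hp1)) (hpd.symm ▸ hd) hr hrk rfl
  rw [hpd] at hfail
  refine le_trans (sub_le_sub_left ?_ 1) hfail
  exact (mul_le_mul_of_nonneg_left (factorial_mul_pow_le_exp hc (by positivity) hφ hr_le hr_ge)
    (sq_nonneg _)).trans (ncard_edgeSet_sq_mul_exp_le G hn)

lemma choose_two_le_of_log_le {n : ℕ} {T : ℝ} (hn : Real.log n ≤ T) :
    (n.choose 2 : ℝ) ≤ 32 * Real.exp T * Real.log n ^ 5 * n := by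
  rcases lt_or_ge n 2 with hlt | hge
  · rw [Nat.choose_eq_zero_of_lt hlt, Nat.cast_zero]
    have := Real.log_natCast_nonneg n
    positivity
  have hn2 : (2 : ℝ) ≤ n := by exact_mod_cast hge
  have hlog : 1 / 2 ≤ Real.log n := by
    linarith [Real.log_two_gt_d9, Real.log_le_log zero_lt_two hn2]
  calc (n.choose 2 : ℝ) ≤ (n : ℝ) ^ 2 := by exact_mod_cast Nat.choose_le_pow n 2
    _ = n * n := sq _
    _ ≤ Real.exp T * n := by
        gcongr
        exact (Real.log_le_iff_le_exp (by linarith)).1 hn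
    _ = 32 * Real.exp T * (1 / 2) ^ 5 * n := by ring
    _ ≤ 32 * Real.exp T * Real.log n ^ 5 * n := by gcongr

lemma one_sub_inv_le_measureReal_ncard_lightEdges_le_of_log_le (w : Sym2 V → ℝ) (G : SimpleGraph V)
    (F : Ω → SimpleGraph V) {T : ℝ} (hn : Real.log (Fintype.card V) ≤ T) :
    1 - 1 / (Fintype.card V : ℝ) ≤ μ.real {ω | ((lightEdges w G (F ω)).ncard : ℝ) ≤
      32 * Real.exp T * Real.log (Fintype.card V) ^ 5 * Fintype.card V} := by
  have hfew : {ω | ((lightEdges w G (F ω)).ncard : ℝ) ≤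
      32 * Real.exp T * Real.log (Fintype.card V) ^ 5 * Fintype.card V} = Set.univ :=
    Set.eq_univ_of_forall fun ω => (Nat.cast_le.2 (ncard_lightEdges_le_choose_two w G (F ω))).trans
      (choose_two_le_of_log_le hn)
  rw [hfew, probReal_univ]
  exact sub_le_self _ (by positivity)

end LightEdges

theorem mainTheorem6 (c : ℝ) (hc : 0 < c) :
    ∃ (C : ℝ) (A : ℕ), 0 < C ∧
      ∀ (V : Type u) [Fintype V] (G : SimpleGraph V) (w : Sym2 V → ℝ),
        Set.InjOn w G.edgeSet →
      ∀ (p : ℝ), 0 < p → p ≤ 1 →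
      ∀ (k : ℕ), c * Real.log (Fintype.card V) ≤ (k : ℝ) →
      ∀ (Ω : Type v) [MeasurableSpace Ω] (μ : Measure Ω) [IsProbabilityMeasure μ]
        (H F : Ω → SimpleGraph V),
        IsKWiseSample μ G p k H →
        (∀ ω, IsMinWeightForest w (H ω) (F ω)) →
        1 - 1 / (Fintype.card V : ℝ) ≤
          μ.real {ω | ((lightEdges w G (F ω)).ncard : ℝ) ≤
            C * (Real.log (Fintype.card V)) ^ A * (Fintype.card V / p)} := by
  set T := max 1 (2 / c)
  set K := 676 * c ^ 2 * Real.exp (20 / c)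
  refine ⟨6 * K + 32 * Real.exp T, 5, by positivity, ?_⟩
  intro V _ G w hw p hp hp1 k hk Ω _ μ _ H F hH hF
  set L := Real.log (Fintype.card V)
  have : 0 ≤ L := Real.log_natCast_nonneg _
  rcases le_total L T with hsmall | hlarge
  · refine (one_sub_inv_le_measureReal_ncard_lightEdges_le_of_log_le w G F hsmall).trans
      (measureReal_le_mono _ ?_)
    gcongr
    · exact le_add_of_nonneg_left (by positivity)
    · exact le_div_self (Nat.cast_nonneg _) hp hp1
  · obtain ⟨hL, hcL⟩ := max_le_iff.1 hlarge
    refine (one_sub_inv_le_measureReal_ncard_lightEdges_le hc hw hp hp1 hk hH hF hL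
      ((div_le_iff₀' hc).1 hcL)).trans (measureReal_le_mono _ ?_)
    calc _ ≤ 6 * (sampledDegree c L / p) * L * Fintype.card V :=
          edgeThreshold_le (by unfold sampledDegree; positivity) hL
      _ = 6 * K * L ^ 5 * (Fintype.card V / p) := by unfold sampledDegree; ring
      _ ≤ (6 * K + 32 * Real.exp T) * L ^ 5 * (Fintype.card V / p) := by
          gcongr
          exact le_add_of_nonneg_right (by positivity)
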